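/- \textbf{Setting.} A \emph{Clifford circuit} $\mathcal C$ on $n$ qubits is a finite sequence of operations in chronological order. Each operation is a Clifford unitary or the measurement of a Pauli operator $S_j=\pm P_j$ ($j=1,\dots,m$), and has a level in $\{1,2,\dots\}$; distinct operations of the same level have disjoint supports. The measurement of $S_j$ has level $\ell_j$, the depth $\Delta$ is the maximum level, and $U_\ell$ is the product of the unitary operations of level $\ell$. Write $\overline{\mathcal P}_N$ for the group of $N$-qubit Pauli operators up to phase, and $[P,Q]\in\mathbb Z_2$ for $0$ if $P,Q$ commute and $1$ otherwise. A \emph{fault operator} is an element $F=(F_{\ell+0.5})_{0\le\ell\le\Delta}$ of $\overline{\mathcal P}_{n(\Delta+1)}$, with $F_{\ell+0.5}\in\overline{\mathcal P}_n$ applied right after level $\ell$ (for $\ell=0$, to the input). Let $\mathbb P^{(F)}_{\mathcal C,\rho}(o)$ be the probability of the outcome bit-string $o\in\mathbb Z_2^m$ when the circuit is run with input state $\rho$ and faults $F$. The \emph{outcome code} $\mathcal O(\mathcal C)\subseteq\mathbb Z_2^m$ is the set of all bit-strings $o$ that have non-zero probability for some input state in the absence of faults. Assume that $\mathcal O(\mathcal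 C)$ is linear (it is always an affine subspace, so this means $0\in\mathcal O(\mathcal C)$). The \emph{cumulant} $\overrightarrow F$ and the \emph{back-cumulant} $\overleftarrow F$ of $F$ are given by $\overrightarrow F_{0.5}=F_{0.5}$, $\overrightarrow F_{\ell+0.5}=F_{\ell+0.5}\,U_\ell\overrightarrow F_{\ell-0.5}U_\ell^{-1}$ and $\overleftarrow F_{\Delta+0.5}=F_{\Delta+0.5}$, $\overleftarrow F_{\ell-0.5}=F_{\ell-0.5}\,U_\ell^{-1}\overleftarrow F_{\ell+0.5}U_\ell$. The \emph{effect} of $F$ is $\mathrm{eff}(F)=(f,E)\in\mathbb Z_2^m\times\overline{\mathcal P}_n$ with $f_j=[\overrightarrow F_{\ell_j-0.5},S_j]$ and $E=\overrightarrow F_{\Delta+0.5}$. Let $u_1,\dots,u_r$ generate $\mathcal O(\mathcal C)^\perp$, and let $\sigma_{\mathcal O}:\mathbb Z_2^m\to\mathbb Z_2^r$, $\sigma_{\mathcal O}(v)_i=(u_i|v)$. For $u\in\mathcal O(\mathcal C)^\perp$ let $F(u)$ be the product over $j$ with $u_j=1$ of the fault operators equal to $S_j$ at level $\ell_j-0.5$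 and to the identity elsewhere. The \emph{spacetime code} $\mathcal Q(\mathcal C)$ is the stabilizer code with generators $\overleftarrow{F(u_1)},\dots,\overleftarrow{F(u_r)}$; its syndrome map is $\sigma_{\mathcal Q}(F)_i=[\overleftarrow{F(u_i)},F]$. Let $\mathbb P_{\mathcal F}$ be a probability distribution on the fault operators. A \emph{most likely error (MLE) decoder} for $\mathcal Q(\mathcal C)$ is a map $D_{\mathcal Q}:\mathbb Z_2^r\to\overline{\mathcal P}_{n(\Delta+1)}$ that sends each syndrome $s$ in the image of $\sigma_{\mathcal Q}$ to an element of maximum probability $\mathbb P_{\mathcal F}$ among the $F$ with $\sigma_{\mathcal Q}(F)=s$. A \emph{most likely fault (MLF) decoder} for $\mathcal C$ is a map $\mathbb Z_2^m\to\mathbb Z_2^m\times\overline{\mathcal P}_n$ that sends each $o$ to $\mathrm{eff}(\hat F)$ for some fault operator $\hat F$ that maximizes $\mathbb P^{(\hat F)}_{\mathcal C,\rho_M}(o)\,\mathbb P_{\mathcal F}(\hat F)$ among all fault operators, where $\rho_M=(I/2)^{\otimes n}$ is the maximally mixed state. \textbf{Theorem.} If $D_{\mathcal Q}$ is an MLE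 decoder for the spacetime code $\mathcal Q(\mathcal C)$, then $\mathrm{eff}\circ D_{\mathcal Q}\circ\sigma_{\mathcal O}$ is an MLF decoder for the circuit $\mathcal C$. -/

import Mathlib

open scoped Matrix ComplexOrder

noncomputable section

namespace SpacetimeCode

/-! ### Pauli operators -/

/-- The group of Pauli operators up to phase on the qubits indexed by `ι`. On each qubit the pair
`(a, b)` stands for `X ^ a * Z ^ b` up to a phase, so `(0, 0), (1, 0), (1, 1), (0, 1)` are
`I, X, Y, Z`. The product of Pauli operators up to phase is the addition of this group. -/
abbrev Pauli (ι : Type) : Type := ι → ZMod 2 × ZMod 2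

/-- Operators on the Hilbert space of the qubits indexed by `ι`, as matrices in the
computational basis. -/
abbrev Operator (ι : Type) : Type := Matrix (ι → Fin 2) (ι → Fin 2) ℂ

/-- The single-qubit Pauli matrices. -/
def pauliMatrix (p : ZMod 2 × ZMod 2) : Matrix (Fin 2) (Fin 2) ℂ :=
  if p.1 = 0 then
    if p.2 = 0 then !![1, 0; 0, 1] else !![1, 0; 0, -1]
  else
    if p.2 = 0 then !![0, 1; 1, 0] else !![0, -Complex.I; Complex.I, 0]

section Operators

variable {ι : Type} [Fintype ι]

/-- The tensor product of the matrices `I, X, Y, Z` that represents `P`. -/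
def Pauli.toOperator (P : Pauli ι) : Operator ι :=
  Matrix.of fun x y => ∏ q, pauliMatrix (P q) (x q) (y q)

variable [DecidableEq ι]

/-- The commutator `[P, Q]`: it is `0` if the two operators commute, and `1` otherwise. -/
def pauliCommutator (P Q : Pauli ι) : ZMod 2 :=
  open Classical in if Commute P.toOperator Q.toOperator then 0 else 1

/-- `A` is a Pauli operator, with a phase in `{1, i, -1, -i}`, and `P` is its class up to phase. -/
def IsPauliOperatorOfClass (A : Operator ι) (P : Pauli ι) : Prop :=
  ∃ k : Fin 4, A = Complex.I ^ (k : ℕ) • P.toOperator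

/-- A Clifford unitary: it conjugates Pauli operators to Pauli operators. -/
def IsClifford (U : Operator ι) : Prop :=
  U ∈ Matrix.unitaryGroup (ι → Fin 2) ℂ ∧
    ∀ P : Pauli ι, ∃ Q : Pauli ι, IsPauliOperatorOfClass (U * P.toOperator * Uᴴ) Q

/-- The conjugation `U P U⁻¹` of `P` by a Clifford unitary `U`, up to phase. (The value `0` is
never taken by default for a Clifford unitary.) -/
def conjugate (U : Operator ι) (P : Pauli ι) : Pauli ι :=
  open Classical in
  if h : ∃ Q : Pauli ι, IsPauliOperatorOfClass (U * P.toOperator * Uᴴ) Q then h.choose else 0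

/-- `A` acts trivially on the qubit `q`: `A` is the tensor product of the identity of the qubit
`q` with an operator on the other qubits. -/
def ActsTriviallyOn (A : Operator ι) (q : ι) : Prop :=
  ∀ x y : ι → Fin 2,
    A x y = if x q = y q then A (Function.update x q 0) (Function.update y q 0) else 0

/-- The support of an operator: the set of qubits on which it acts non-trivially. -/
def support (A : Operator ι) : Set ι := {q | ¬ ActsTriviallyOn A q}

/-- Density matrices. -/
def IsState (ρ : Operator ι) : Prop := ρ.PosSemidef ∧ ρ.trace = 1

/-- The maximally mixed state `(I / 2) ^ ⊗ι`. -/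
def maximallyMixed (ι : Type) [Fintype ι] [DecidableEq ι] : Operator ι :=
  ((2 : ℂ) ^ Fintype.card ι)⁻¹ • (1 : Operator ι)

end Operators

/-! ### Clifford circuits -/

/-- A Clifford operation on `n` qubits is a Clifford unitary or the measurement of a Hermitian
Pauli operator `(-1) ^ sign * P`. -/
inductive CliffordOperation (n : ℕ) : Type
  | unitary (U : Operator (Fin n)) (hU : IsClifford U) : CliffordOperation n
  | measurement (sign : ZMod 2) (P : Pauli (Fin n)) : CliffordOperation n

namespace CliffordOperation

variable {n : ℕ}

/-- The operation is a measurement. -/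
def IsMeasurement : CliffordOperation n → Prop
  | unitary _ _ => False
  | measurement _ _ => True

instance : DecidablePred (IsMeasurement (n := n))
  | unitary _ _ => isFalse (fun h => h)
  | measurement _ _ => isTrue trivial

/-- The unitary that is applied, or the operator that is measured. -/
def operator : CliffordOperation n → Operator (Fin n)
  | unitary U _ => U
  | measurement sign P => (-1 : ℂ) ^ sign.val • P.toOperator

/-- The measured Pauli operator up to phase (only used for measurements). -/
def measuredPauli : CliffordOperation n → Pauli (Fin n)
  | unitary _ _ => 0
  | measurement _ P => P

/-- The unitary part of an operation, which is the identity for a measurement. -/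
def unitaryPart : CliffordOperation n → Operator (Fin n)
  | unitary U _ => U
  | measurement _ _ => 1

end CliffordOperation

/-- A Clifford circuit on `n` qubits: a sequence of Clifford operations in chronological order,
each with a level in `{1, 2, …}`, such that distinct operations with the same level have disjoint
supports. -/
structure CliffordCircuit (n : ℕ) : Type where
  size : ℕ
  op : Fin size → CliffordOperation n
  level : Fin size → ℕ
  one_le_level : ∀ i, 1 ≤ level i
  chronological : Monotone level
  disjoint_support : ∀ i j, i ≠ j → level i = level j →
    Disjoint (support (op i).operator) (support (op j).operator)

namespace CliffordCircuit

variable {n : ℕ} (C : CliffordCircuit n)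

/-- The depth of a circuit is the maximum level of its operations (`0` for an empty circuit). -/
def depth : ℕ := Finset.univ.sup C.level

/-- The measurements of the circuit. They index the `m` bits of the outcome bit-strings. -/
abbrev Measurement : Type := {i : Fin C.size // (C.op i).IsMeasurement}

/-- The space `ℤ₂ ^ m` of outcome bit-strings. -/
abbrev BitString : Type := C.Measurement → ZMod 2

/-- Fault operators: Pauli operators up to phase on `n * (Δ + 1)` qubits, where `Δ` is the depth.
The qubit `(ℓ, q)` is the one at the half-integer level `ℓ + 0.5`. -/
abbrev FaultOperator : Type := Pauli (Fin (C.depth + 1) × Fin n)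

/-- The operations of level `ℓ`, in chronological order. -/
def opsAtLevel (ℓ : ℕ) : List (Fin C.size) :=
  (List.finRange C.size).filter fun i => C.level i = ℓ

/-- The product `U_ℓ` of all the unitary operations of level `ℓ` (later ones on the left). -/
def levelUnitary (ℓ : ℕ) : Operator (Fin n) :=
  ((C.opsAtLevel ℓ).map fun i => (C.op i).unitaryPart).reverse.prod

variable {C}

/-- The component at the half-integer level `ℓ + 0.5` of a fault operator, for `0 ≤ ℓ ≤ Δ`. -/
def FaultOperator.component (F : C.FaultOperator) (ℓ : ℕ) : Pauli (Fin n) :=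
  fun q => if h : ℓ < C.depth + 1 then F (⟨ℓ, h⟩, q) else 0

variable (C)

/-- The fault operator `η_{ℓ + 0.5}(P)` with `P` at level `ℓ + 0.5` and the identity elsewhere. -/
def place (ℓ : ℕ) (P : Pauli (Fin n)) : C.FaultOperator :=
  fun x => if (x.1 : ℕ) = ℓ then P x.2 else 0

/-! ### Execution of a circuit with faults -/

/-- The operator applied to the state by the operation `i` when the outcomes are `o`: the unitary,
or the projector `(I + (-1) ^ o_i S_i) / 2`. -/
def krausOp (o : C.BitString) (i : Fin C.size) : Operator (Fin n) :=
  if h : (C.op i).IsMeasurement then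
    (2 : ℂ)⁻¹ • (1 + (-1 : ℂ) ^ (o ⟨i, h⟩).val • (C.op i).operator)
  else (C.op i).operator

/-- The operator applied to the input state by the first `ℓ` levels of the circuit when the
outcomes are `o` and the faults are `F`: the fault `F_{0.5}` hits the input, then every level `ℓ`
is followed by the fault `F_{ℓ + 0.5}`. -/
def krausUpTo (F : C.FaultOperator) (o : C.BitString) : ℕ → Operator (Fin n)
  | 0 => (FaultOperator.component F 0).toOperator
  | ℓ + 1 => (FaultOperator.component F (ℓ + 1)).toOperator *
      ((C.opsAtLevel (ℓ + 1)).map (C.krausOp o)).reverse.prod * krausUpTo F o ℓ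

/-- The probability of the outcome bit-string `o` for the input state `ρ` and the faults `F`
(Born rule). -/
def outcomeProb (ρ : Operator (Fin n)) (F : C.FaultOperator) (o : C.BitString) : ℝ :=
  (C.krausUpTo F o C.depth * ρ * (C.krausUpTo F o C.depth)ᴴ).trace.re

/-! ### Outcome code -/

/-- The outcome code: the set of all the outcome bit-strings that are possible in the absence of
faults, for some input state. -/
def outcomeCode : Set C.BitString :=
  {o | ∃ ρ : Operator (Fin n), IsState ρ ∧ 0 < C.outcomeProb ρ 0 o}

/-- The dual of the outcome code. Its elements are the checks. -/
def dualOutcomeCode : Submodule (ZMod 2) C.BitString where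
  carrier := {u | ∀ o ∈ C.outcomeCode, u ⬝ᵥ o = 0}
  add_mem' := fun ha hb o ho => by rw [add_dotProduct, ha o ho, hb o ho, add_zero]
  zero_mem' := fun o _ => zero_dotProduct o
  smul_mem' := fun c a ha o ho => by rw [smul_dotProduct, ha o ho, smul_zero]

/-- The syndrome map of the outcome code for the checks `u₁, …, u_r`. -/
def outcomeSyndrome {r : ℕ} (u : Fin r → C.BitString) (v : C.BitString) : Fin r → ZMod 2 :=
  fun i => u i ⬝ᵥ v

/-! ### Propagation of faults -/

/-- The component at level `ℓ + 0.5` of the cumulant of `F`, for `0 ≤ ℓ ≤ Δ`. -/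
def cumulant (F : C.FaultOperator) : ℕ → Pauli (Fin n)
  | 0 => FaultOperator.component F 0
  | ℓ + 1 => FaultOperator.component F (ℓ + 1) +
      conjugate (C.levelUnitary (ℓ + 1)) (cumulant F ℓ)

/-- The component at level `Δ - k + 0.5` of the back-cumulant of `F`, for `0 ≤ k ≤ Δ`. -/
def backCumulantAux (F : C.FaultOperator) : ℕ → Pauli (Fin n)
  | 0 => FaultOperator.component F C.depth
  | k + 1 => FaultOperator.component F (C.depth - (k + 1)) +
      conjugate (C.levelUnitary (C.depth - k))ᴴ (backCumulantAux F k)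

/-- The back-cumulant of `F`. -/
def backCumulant (F : C.FaultOperator) : C.FaultOperator :=
  fun x => C.backCumulantAux F (C.depth - x.1) x.2

/-- The effect `(f, E)` of a fault operator: the flipped outcomes `f_j = [cumulant just before the
measurement j, S_j]` and the residual error `E` at the end of the circuit. -/
def eff (F : C.FaultOperator) : C.BitString × Pauli (Fin n) :=
  (fun j => pauliCommutator (C.cumulant F (C.level j - 1)) (C.op j).measuredPauli,
    C.cumulant F C.depth)

/-! ### Spacetime code -/

/-- The fault operator `F(u)`, the product of the `η_{ℓ_j - 0.5}(S_j ^ u_j)`. -/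
def checkFault (u : C.BitString) : C.FaultOperator :=
  ∑ j : C.Measurement, u j • C.place (C.level j - 1) (C.op j).measuredPauli

/-- The check operator of `u`, which is the back-cumulant of `F(u)`. The check operators of the
elements of the dual of the outcome code are the stabilizers of the spacetime code. -/
def checkOperator (u : C.BitString) : C.FaultOperator := C.backCumulant (C.checkFault u)

end CliffordCircuit

/-! ### Decoders -/

/-- The syndrome map of the stabilizer code with generators `S₁, …, S_r`. -/
def stabilizerSyndrome {ι : Type} [Fintype ι] [DecidableEq ι] {r : ℕ} (S : Fin r → Pauli ι)
    (E : Pauli ι) : Fin r → ZMod 2 :=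
  fun i => pauliCommutator (S i) E

/-- `D` is a most likely error decoder for the stabilizer code with generators `S₁, …, S_r` and the
error distribution `p`: it maps every syndrome of a Pauli error to an error of maximum probability
among the errors with this syndrome. -/
def IsMLEDecoder {ι : Type} [Fintype ι] [DecidableEq ι] {r : ℕ} (S : Fin r → Pauli ι)
    (p : Pauli ι → ℝ) (D : (Fin r → ZMod 2) → Pauli ι) : Prop :=
  ∀ s : Fin r → ZMod 2, (∃ E, stabilizerSyndrome S E = s) →
    stabilizerSyndrome S (D s) = s ∧ ∀ E, stabilizerSyndrome S E = s → p E ≤ p (D s)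

namespace CliffordCircuit

variable {n : ℕ} (C : CliffordCircuit n)

/-- The quantity `Q_MLF(F, o)`, for the fault distribution `p`. -/
def mlfWeight (p : C.FaultOperator → ℝ) (F : C.FaultOperator) (o : C.BitString) : ℝ :=
  C.outcomeProb (maximallyMixed (Fin n)) F o * p F

/-- `F` is a most likely fault operator given the outcome bit-string `o`. -/
def IsMostLikelyFault (p : C.FaultOperator → ℝ) (o : C.BitString) (F : C.FaultOperator) : Prop :=
  ∀ G : C.FaultOperator, C.mlfWeight p G o ≤ C.mlfWeight p F o

/-- A most likely fault decoder: a circuit decoder that returns, for each outcome bit-string, the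
effect of a most likely fault operator. -/
def IsMLFDecoder (p : C.FaultOperator → ℝ)
    (D : C.BitString → C.BitString × Pauli (Fin n)) : Prop :=
  ∀ o : C.BitString, ∃ F : C.FaultOperator, C.IsMostLikelyFault p o F ∧ D o = C.eff F

end CliffordCircuit

end SpacetimeCode

end

/-! Pushing a fault operator `F` to the end of the circuit leaves a Pauli operator there and flips
the outcomes by `f = flips F`, so the probability of `o` under `F` is the fault-free probability of
`o + f` (`outcomeProb_eq`). For the maximally mixed input the fault-free distribution is uniform on
the outcome code `O`. Hence the MLF weight of `F` is a constant times `p F` if `o + f ∈ O`, and zero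
otherwise. The cumulant and the back-cumulant are adjoint for the symplectic form, so the syndrome
of `F` in the spacetime code is the outcome syndrome of `f` (`sympl_checkOperator`). The condition
`o + f ∈ O` therefore says that `F` has the syndrome computed from `o`, and an MLE decoder maximizes
`p` under exactly this constraint.

The main work is uniformity. Let `W` be the group of translations that preserve the mixed-state
distribution. It contains the flips caused by any Pauli on the input, which the mixed state absorbs,
and by `S_j` just before its measurement, which the measurement absorbs. If `u` is orthogonal to
`W`, the back-cumulant of `F(u)` is thus trivial at the input and commutes with each `S_j` just
before its measurement. Carrying it through the circuit gives `K(o) = c (-1) ^ (u ⬝ᵥ o) K(o)` for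
the Kraus operators `K(o)`, with `c` independent of `o`, so `u` has constant parity on possible
outcomes. As `0 ∈ O`, this parity is zero, and double orthogonality yields `O ⊆ W`; the reverse
inclusion also follows from `0 ∈ O` (`mem_outcomeCode_iff_mem_translations`). -/

namespace SpacetimeCode

/-! ### The symplectic form on Pauli operators, and signs -/

section PauliAlgebra

/-- Equality of operators up to a phase. -/
def PhaseEq {ι : Type} (A B : Operator ι) : Prop := ∃ c : ℂ, ‖c‖ = 1 ∧ A = c • B

variable {ι : Type}

namespace PhaseEq

variable {A B A' B' D : Operator ι}

theorem refl (A : Operator ι) : PhaseEq A A := ⟨1, by simp, by simp⟩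

theorem symm (h : PhaseEq A B) : PhaseEq B A := by
  obtain ⟨c, hc, rfl⟩ := h
  have : c ≠ 0 := fun h => by simp [h] at hc
  exact ⟨c⁻¹, by simp [hc], by rw [smul_smul, inv_mul_cancel₀ this, one_smul]⟩

theorem trans (h : PhaseEq A B) (h' : PhaseEq B D) : PhaseEq A D := by
  obtain ⟨c, hc, rfl⟩ := h
  obtain ⟨d, hd, rfl⟩ := h'
  exact ⟨c * d, by simp [hc, hd], by rw [smul_smul]⟩

theorem of_eq (h : A = B) : PhaseEq A B := h ▸ refl A

theorem mul [Fintype ι] [DecidableEq ι] (h : PhaseEq A B) (h' : PhaseEq A' B') :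
    PhaseEq (A * A') (B * B') := by
  obtain ⟨c, hc, rfl⟩ := h
  obtain ⟨d, hd, rfl⟩ := h'
  exact ⟨c * d, by simp [hc, hd], by rw [smul_mul_smul_comm]⟩

end PhaseEq

/-- The symplectic form of two Pauli operators. -/
def sympl [Fintype ι] (P Q : Pauli ι) : ZMod 2 := ∑ q, ((P q).1 * (Q q).2 + (P q).2 * (Q q).1)

section

variable [Fintype ι]

theorem sympl_add_left (P P' Q : Pauli ι) : sympl (P + P') Q = sympl P Q + sympl P' Q := by
  simp only [sympl, ← Finset.sum_add_distrib, Pi.add_apply, Prod.fst_add, Prod.snd_add]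
  exact Finset.sum_congr rfl fun q _ => by ring

theorem sympl_comm (P Q : Pauli ι) : sympl P Q = sympl Q P := by
  simp only [sympl]
  exact Finset.sum_congr rfl fun q _ => by ring

theorem sympl_add_right (P Q Q' : Pauli ι) : sympl P (Q + Q') = sympl P Q + sympl P Q' := by
  rw [sympl_comm, sympl_add_left, sympl_comm Q, sympl_comm Q']

@[simp] theorem sympl_zero_left (Q : Pauli ι) : sympl 0 Q = 0 := by simp [sympl]

@[simp] theorem sympl_zero_right (Q : Pauli ι) : sympl Q 0 = 0 := by simp [sympl]

theorem sympl_smul_left (c : ZMod 2) (P Q : Pauli ι) : sympl (c • P) Q = c * sympl P Q := by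
  simp only [sympl, Finset.mul_sum, Pi.smul_apply, Prod.smul_fst, Prod.smul_snd, smul_eq_mul]
  exact Finset.sum_congr rfl fun q _ => by ring

theorem sympl_sum_left {κ : Type*} (s : Finset κ) (P : κ → Pauli ι) (Q : Pauli ι) :
    sympl (∑ k ∈ s, P k) Q = ∑ k ∈ s, sympl (P k) Q := by
  classical
  induction s using Finset.induction_on with
  | empty => simp
  | insert a s ha ih => rw [Finset.sum_insert ha, Finset.sum_insert ha, sympl_add_left, ih]

/-- Nondegeneracy: pairing with `X` and `Z` on a single qubit reads off the two bits of `P` there.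
-/
theorem eq_zero_of_sympl_eq_zero [DecidableEq ι] (P : Pauli ι) (h : ∀ Q, sympl P Q = 0) :
    P = 0 := by
  funext q
  have h1 := h (Pi.single q (1, 0))
  have h2 := h (Pi.single q (0, 1))
  unfold sympl at h1 h2
  rw [Finset.sum_eq_single q (fun b _ hb => by simp [Pi.single_eq_of_ne hb]) (by simp)] at h1 h2
  simp at h1 h2
  exact Prod.ext h2 h1

theorem sympl_injective [DecidableEq ι] (P P' : Pauli ι) (h : ∀ Q, sympl P Q = sympl P' Q) :
    P = P' := by
  have : P + P' = 0 := eq_zero_of_sympl_eq_zero _ fun Q => by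
    rw [sympl_add_left, h, CharTwo.add_self_eq_zero]
  rw [eq_neg_of_add_eq_zero_left this, ZModModule.neg_eq_self]

/-- The sign `(-1) ^ a` of a bit `a`. -/
def bitSign (a : ZMod 2) : ℂ := (-1) ^ a.val

@[simp] theorem bitSign_zero : bitSign 0 = 1 := by simp [bitSign]

@[simp] theorem bitSign_one : bitSign 1 = -1 := by simp [bitSign, ZMod.val_one]

theorem zmod_two_cases (a : ZMod 2) : a = 0 ∨ a = 1 := by revert a; decide

theorem bitSign_add (a b : ZMod 2) : bitSign (a + b) = bitSign a * bitSign b := by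
  rcases zmod_two_cases a with rfl | rfl <;> rcases zmod_two_cases b with rfl | rfl <;>
    simp [CharTwo.add_self_eq_zero]

theorem bitSign_sum {κ : Type*} (s : Finset κ) (a : κ → ZMod 2) :
    bitSign (∑ k ∈ s, a k) = ∏ k ∈ s, bitSign (a k) := by
  classical
  induction s using Finset.induction_on with
  | empty => simp
  | insert b s hb ih => rw [Finset.sum_insert hb, Finset.prod_insert hb, bitSign_add, ih]

theorem bitSign_mul_self (a : ZMod 2) : bitSign a * bitSign a = 1 := by
  rw [← bitSign_add, CharTwo.add_self_eq_zero, bitSign_zero]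

theorem norm_bitSign (a : ZMod 2) : ‖bitSign a‖ = 1 := by simp [bitSign]

theorem bitSign_injective {a b : ZMod 2} (h : bitSign a = bitSign b) : a = b := by
  rcases zmod_two_cases a with rfl | rfl <;> rcases zmod_two_cases b with rfl | rfl <;>
    first | rfl | norm_num at h

/-! ### Pauli matrices and their tensor products -/

theorem pauliMatrix_mul (p q : ZMod 2 × ZMod 2) :
    ∃ c : ℂ, ‖c‖ = 1 ∧ pauliMatrix p * pauliMatrix q = c • pauliMatrix (p + q) := by
  have h2 : (1 + 1 : ZMod 2) = 0 := CharTwo.add_self_eq_zero 1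
  obtain ⟨a, b⟩ := p
  obtain ⟨a', b'⟩ := q
  rcases zmod_two_cases a with rfl | rfl <;> rcases zmod_two_cases b with rfl | rfl <;>
  rcases zmod_two_cases a' with rfl | rfl <;> rcases zmod_two_cases b' with rfl | rfl <;>
  first
  | refine ⟨1, by simp, ?_⟩
    simp [pauliMatrix, h2]
    done
  | refine ⟨Complex.I, by simp, ?_⟩
    simp [pauliMatrix, h2]
    done
  | refine ⟨-Complex.I, by simp, ?_⟩
    simp [pauliMatrix, h2]

theorem pauliMatrix_mul_comm (p q : ZMod 2 × ZMod 2) :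
    pauliMatrix p * pauliMatrix q =
      bitSign (p.1 * q.2 + p.2 * q.1) • (pauliMatrix q * pauliMatrix p) := by
  have h2 : (1 + 1 : ZMod 2) = 0 := CharTwo.add_self_eq_zero 1
  obtain ⟨a, b⟩ := p
  obtain ⟨a', b'⟩ := q
  rcases zmod_two_cases a with rfl | rfl <;> rcases zmod_two_cases b with rfl | rfl <;>
  rcases zmod_two_cases a' with rfl | rfl <;> rcases zmod_two_cases b' with rfl | rfl <;>
  simp [pauliMatrix, h2]

theorem pauliMatrix_mul_self (p : ZMod 2 × ZMod 2) : pauliMatrix p * pauliMatrix p = 1 := by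
  obtain ⟨a, b⟩ := p
  rcases zmod_two_cases a with rfl | rfl <;> rcases zmod_two_cases b with rfl | rfl <;>
  simp [pauliMatrix, Matrix.one_fin_two]

theorem conjTranspose_pauliMatrix (p : ZMod 2 × ZMod 2) : (pauliMatrix p)ᴴ = pauliMatrix p := by
  obtain ⟨a, b⟩ := p
  rcases zmod_two_cases a with rfl | rfl <;> rcases zmod_two_cases b with rfl | rfl <;>
  ext i j <;> fin_cases i <;> fin_cases j <;> simp [pauliMatrix]

variable [DecidableEq ι]

/-- The product of tensor products of single-qubit matrices. -/
theorem tensor_mul (A B : ι → Matrix (Fin 2) (Fin 2) ℂ) :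
    (Matrix.of fun x y => ∏ q, A q (x q) (y q) : Operator ι) *
      (Matrix.of fun x y => ∏ q, B q (x q) (y q) : Operator ι) =
    Matrix.of fun x y => ∏ q, (A q * B q) (x q) (y q) := by
  ext x y
  simp only [Matrix.mul_apply, Matrix.of_apply, ← Finset.prod_mul_distrib]
  rw [Finset.prod_univ_sum, Fintype.piFinset_univ]

theorem toOperator_mul (P Q : Pauli ι) :
    PhaseEq (P.toOperator * Q.toOperator) (P + Q).toOperator := by
  choose c hc h using pauliMatrix_mul
  refine ⟨∏ q, c (P q) (Q q), by simp [norm_prod, hc], ?_⟩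
  rw [Pauli.toOperator, Pauli.toOperator, tensor_mul]
  ext x y
  simp [Pauli.toOperator, h, Finset.prod_mul_distrib]

theorem toOperator_mul_comm (P Q : Pauli ι) :
    P.toOperator * Q.toOperator = bitSign (sympl P Q) • (Q.toOperator * P.toOperator) := by
  simp only [Pauli.toOperator, tensor_mul]
  ext x y
  simp only [Matrix.of_apply, pauliMatrix_mul_comm (P _) (Q _), Matrix.smul_apply, smul_eq_mul,
    Finset.prod_mul_distrib, sympl, bitSign_sum]

omit [DecidableEq ι] in
@[simp] theorem toOperator_zero : (0 : Pauli ι).toOperator = 1 := by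
  ext x y
  rw [Pauli.toOperator, Matrix.of_apply, Matrix.one_apply]
  have : ∀ i j, pauliMatrix 0 i j = if i = j then 1 else 0 := by
    intro i j
    fin_cases i <;> fin_cases j <;> simp [pauliMatrix]
  simp only [Pi.zero_apply, this, Finset.prod_ite_zero, Finset.prod_const_one, Finset.mem_univ,
    true_imp_iff, funext_iff]

@[simp] theorem toOperator_mul_self (P : Pauli ι) : P.toOperator * P.toOperator = 1 := by
  simp only [Pauli.toOperator, tensor_mul]
  rw [← toOperator_zero, Pauli.toOperator]
  ext x y
  simp only [Matrix.of_apply, pauliMatrix_mul_self]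
  simp [pauliMatrix, Matrix.one_fin_two]

omit [DecidableEq ι] in
@[simp] theorem conjTranspose_toOperator (P : Pauli ι) : P.toOperatorᴴ = P.toOperator := by
  ext x y
  simp only [Pauli.toOperator, Matrix.conjTranspose_apply, Matrix.of_apply, star_prod]
  exact Finset.prod_congr rfl fun q _ => by
    rw [← Matrix.conjTranspose_apply, conjTranspose_pauliMatrix]

theorem toOperator_ne_zero (P : Pauli ι) : P.toOperator ≠ 0 := fun h => by
  have := toOperator_mul_self P
  rw [h, zero_mul] at this
  exact zero_ne_one this

/-- The product `Q P` is a nonzero matrix, so the sign in a commutation relation is unique. This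
turns matrix identities into values of the form. -/
theorem sympl_eq_of_commutation {P Q : Pauli ι} {a : ZMod 2}
    (h : P.toOperator * Q.toOperator = bitSign a • (Q.toOperator * P.toOperator)) :
    sympl P Q = a := by
  rw [toOperator_mul_comm] at h
  have h0 : Q.toOperator * P.toOperator ≠ 0 := fun h0 => by
    obtain ⟨c, hc, h1⟩ := (toOperator_mul Q P).symm
    rw [h0, smul_zero] at h1
    exact toOperator_ne_zero _ h1
  exact bitSign_injective (smul_left_injective ℂ h0 h)

theorem pauliCommutator_eq_sympl (P Q : Pauli ι) : pauliCommutator P Q = sympl P Q := by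
  unfold pauliCommutator
  split_ifs with h
  · exact (sympl_eq_of_commutation (by simpa using h.eq)).symm
  · rcases zmod_two_cases (sympl P Q) with h' | h'
    · refine absurd ?_ h
      rw [commute_iff_eq, toOperator_mul_comm, h', bitSign_zero, one_smul]
    · exact h'.symm

/-- A Pauli operator up to phase is determined by its matrix up to a scalar. -/
theorem eq_of_smul_toOperator {P Q : Pauli ι} (h : PhaseEq P.toOperator Q.toOperator) : P = Q := by
  obtain ⟨c, -, h⟩ := h
  refine sympl_injective _ _ fun R => sympl_eq_of_commutation ?_
  rw [h, smul_mul_assoc, toOperator_mul_comm, smul_comm, mul_smul_comm]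

/-! ### Conjugation by Clifford unitaries -/

omit [DecidableEq ι] in
theorem isPauliOperatorOfClass_phaseEq {A : Operator ι} {P : Pauli ι}
    (h : IsPauliOperatorOfClass A P) : PhaseEq A P.toOperator := by
  obtain ⟨k, rfl⟩ := h
  exact ⟨_, by simp, rfl⟩

omit [DecidableEq ι] in
theorem IsPauliOperatorOfClass.I_pow_smul {A : Operator ι} {P : Pauli ι}
    (h : IsPauliOperatorOfClass A P) (m : ℕ) :
    IsPauliOperatorOfClass (Complex.I ^ m • A) P := by
  obtain ⟨k, rfl⟩ := h
  refine ⟨⟨(m + k) % 4, Nat.mod_lt _ (by norm_num)⟩, ?_⟩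
  rw [smul_smul, ← pow_add]
  simp only
  rw [← Complex.I_pow_eq_pow_mod]

namespace IsClifford

variable {U V : Operator ι}

theorem conjTranspose_mul (hU : IsClifford U) : Uᴴ * U = 1 := Matrix.mem_unitaryGroup_iff'.1 hU.1

theorem mul_conjTranspose (hU : IsClifford U) : U * Uᴴ = 1 := Matrix.mem_unitaryGroup_iff.1 hU.1

theorem one : IsClifford (1 : Operator ι) :=
  ⟨one_mem _, fun P => ⟨P, 0, by simp⟩⟩

theorem mul (hU : IsClifford U) (hV : IsClifford V) : IsClifford (U * V) := by
  refine ⟨mul_mem hU.1 hV.1, fun P => ?_⟩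
  obtain ⟨Q, k, hQ⟩ := hV.2 P
  obtain ⟨R, hR⟩ := hU.2 Q
  refine ⟨R, ?_⟩
  have : U * V * P.toOperator * (U * V)ᴴ = Complex.I ^ (k : ℕ) • (U * Q.toOperator * Uᴴ) := by
    calc _ = U * (V * P.toOperator * Vᴴ) * Uᴴ := by
          simp only [Matrix.conjTranspose_mul, mul_assoc]
      _ = _ := by rw [hQ, mul_smul_comm, smul_mul_assoc]
  rw [this]
  exact hR.I_pow_smul _

theorem list_prod (l : List (Operator ι)) (h : ∀ A ∈ l, IsClifford A) : IsClifford l.prod := by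
  induction l with
  | nil => exact one
  | cons a l ih =>
    rw [List.prod_cons]
    exact (h a (by simp)).mul (ih fun A hA => h A (by simp [hA]))

theorem conjugate_spec (hU : IsClifford U) (P : Pauli ι) :
    IsPauliOperatorOfClass (U * P.toOperator * Uᴴ) (conjugate U P) := by
  unfold conjugate
  rw [dif_pos (hU.2 P)]
  exact (hU.2 P).choose_spec

/-- A Clifford unitary moves past a Pauli operator by conjugating it. -/
theorem mul_toOperator (hU : IsClifford U) (P : Pauli ι) :
    PhaseEq (U * P.toOperator) ((conjugate U P).toOperator * U) := by
  refine PhaseEq.trans (.of_eq ?_)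
    ((isPauliOperatorOfClass_phaseEq (hU.conjugate_spec P)).mul (.refl U))
  rw [mul_assoc, hU.conjTranspose_mul, mul_one]

/-- `conjugate` is defined by choice; since a Pauli class is determined by its matrix up to phase,
any relation of this shape identifies the chosen value. -/
theorem conjugate_eq (hU : IsClifford U) {P Q : Pauli ι}
    (h : PhaseEq (U * P.toOperator) (Q.toOperator * U)) : conjugate U P = Q := by
  refine eq_of_smul_toOperator ?_
  have := ((hU.mul_toOperator P).symm.trans h).mul (.refl Uᴴ)
  simpa only [mul_assoc, hU.mul_conjTranspose, mul_one] using this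

theorem sympl_conjugate (hU : IsClifford U) (P Q : Pauli ι) :
    sympl (conjugate U P) (conjugate U Q) = sympl P Q := by
  refine sympl_eq_of_commutation ?_
  obtain ⟨c, hc, h⟩ := (isPauliOperatorOfClass_phaseEq (hU.conjugate_spec P)).symm
  obtain ⟨d, hd, h'⟩ := (isPauliOperatorOfClass_phaseEq (hU.conjugate_spec Q)).symm
  have key : ∀ R T : Pauli ι, U * R.toOperator * Uᴴ * (U * T.toOperator * Uᴴ) =
      U * (R.toOperator * T.toOperator) * Uᴴ := fun R T => by
    calc _ = U * R.toOperator * (Uᴴ * U) * T.toOperator * Uᴴ := by simp only [mul_assoc]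
      _ = _ := by rw [hU.conjTranspose_mul, mul_one]; simp only [mul_assoc]
  rw [h, h', smul_mul_smul_comm, smul_mul_smul_comm, key, key, toOperator_mul_comm P Q,
    mul_smul_comm, smul_mul_assoc, smul_comm, mul_comm c d]

theorem conjugate_injective (hU : IsClifford U) :
    Function.Injective (conjugate U : Pauli ι → Pauli ι) := fun P Q h =>
  sympl_injective _ _ fun R => by rw [← hU.sympl_conjugate, h, hU.sympl_conjugate]

/-- Conjugation by `U` preserves the nondegenerate form, so it is injective on a finite set, hence
surjective: every Pauli comes from some `Q`, to which `Uᴴ` sends it back. -/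
theorem conjTranspose (hU : IsClifford U) : IsClifford Uᴴ := by
  refine ⟨Unitary.star_mem hU.1, fun P => ?_⟩
  obtain ⟨Q, rfl⟩ := Finite.surjective_of_injective hU.conjugate_injective P
  refine ⟨Q, ?_⟩
  obtain ⟨k, hk⟩ := hU.conjugate_spec Q
  have h4 : Complex.I ^ (4 - (k : ℕ)) * Complex.I ^ (k : ℕ) = 1 := by
    rw [← pow_add, Nat.sub_add_cancel k.2.le, Complex.I_pow_four]
  have : (conjugate U Q).toOperator = Complex.I ^ (4 - (k : ℕ)) • (U * Q.toOperator * Uᴴ) := by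
    rw [hk, smul_smul, h4, one_smul]
  rw [this, Matrix.conjTranspose_conjTranspose, mul_smul_comm, smul_mul_assoc]
  refine IsPauliOperatorOfClass.I_pow_smul ⟨0, ?_⟩ _
  calc _ = (Uᴴ * U) * Q.toOperator * (Uᴴ * U) := by simp only [mul_assoc]
    _ = _ := by rw [hU.conjTranspose_mul]; simp

theorem conjugate_conjugate_conjTranspose (hU : IsClifford U) (P : Pauli ι) :
    conjugate U (conjugate Uᴴ P) = P := by
  refine hU.conjugate_eq ?_
  have := ((PhaseEq.refl U).mul ((hU.conjTranspose.mul_toOperator P).symm)).mul (.refl U)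
  simp only [mul_assoc, hU.conjTranspose_mul, mul_one] at this
  refine this.trans (.of_eq ?_)
  rw [← mul_assoc, hU.mul_conjTranspose, one_mul]

theorem sympl_conjugate_conjTranspose (hU : IsClifford U) (P Q : Pauli ι) :
    sympl (conjugate Uᴴ P) Q = sympl P (conjugate U Q) := by
  rw [← hU.sympl_conjugate, hU.conjugate_conjugate_conjTranspose]

end IsClifford

/-! ### Operators with disjoint supports -/

omit [Fintype ι] in
theorem ActsTriviallyOn.apply_eq_zero {A : Operator ι} {q : ι} (h : ActsTriviallyOn A q)
    {x y : ι → Fin 2} (hxy : x q ≠ y q) : A x y = 0 := by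
  rw [h x y, if_neg hxy]

omit [Fintype ι] in
theorem ActsTriviallyOn.apply_update {A : Operator ι} {q : ι} (h : ActsTriviallyOn A q)
    {x y : ι → Fin 2} (hxy : x q = y q) (a : Fin 2) :
    A (Function.update x q a) (Function.update y q a) = A x y := by
  rw [h x y, if_pos hxy, h (Function.update x q a)]
  simp

omit [Fintype ι] in
theorem apply_piecewise_of_actsTriviallyOn {A : Operator ι} (T : Finset ι)
    (h : ∀ q ∈ T, ActsTriviallyOn A q) {x y : ι → Fin 2} (hxy : ∀ q ∈ T, x q = y q)
    (z : ι → Fin 2) : A (T.piecewise z x) (T.piecewise z y) = A x y := by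
  induction T using Finset.induction_on with
  | empty => simp
  | insert q T hq ih =>
    rw [Finset.piecewise_insert, Finset.piecewise_insert, (h q (by simp)).apply_update,
      ih (fun a ha => h a (by simp [ha])) (fun a ha => hxy a (by simp [ha]))]
    simp [hq, hxy q (by simp)]

/-- Let `T` be the qubits on which `A` is trivial; `B` is trivial off `T`. In each matrix product
the two factors fix the intermediate index on `T` and off `T`, so a single term survives. -/
theorem commute_of_disjoint_support {A B : Operator ι} (h : Disjoint (support A) (support B)) :
    Commute A B := by
  classical
  let T : Finset ι := Finset.univ.filter fun q => ActsTriviallyOn A q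
  have hA : ∀ q ∈ T, ActsTriviallyOn A q := fun q hq => (Finset.mem_filter.1 hq).2
  have hB : ∀ q ∉ T, ActsTriviallyOn B q := fun q hq => by
    by_contra hB
    exact Set.disjoint_left.1 h (fun h' => hq (by simp [T, h'])) hB
  have key : ∀ x y : ι → Fin 2, (A * B) x y =
      A x (T.piecewise x y) * B (T.piecewise x y) y := fun x y => by
    rw [Matrix.mul_apply]
    refine Finset.sum_eq_single _ (fun z _ hz => ?_) (by simp)
    obtain ⟨q, hq⟩ := Function.ne_iff.1 hz
    by_cases hT : q ∈ T
    · rw [Finset.piecewise_eq_of_mem _ _ _ hT] at hq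
      rw [(hA q hT).apply_eq_zero hq.symm, zero_mul]
    · rw [Finset.piecewise_eq_of_notMem _ _ _ hT] at hq
      rw [(hB q hT).apply_eq_zero hq, mul_zero]
  have key' : ∀ x y : ι → Fin 2, (B * A) x y =
      B x (T.piecewise y x) * A (T.piecewise y x) y := fun x y => by
    rw [Matrix.mul_apply]
    refine Finset.sum_eq_single _ (fun z _ hz => ?_) (by simp)
    obtain ⟨q, hq⟩ := Function.ne_iff.1 hz
    by_cases hT : q ∈ T
    · rw [Finset.piecewise_eq_of_mem _ _ _ hT] at hq
      rw [(hA q hT).apply_eq_zero hq, mul_zero]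
    · rw [Finset.piecewise_eq_of_notMem _ _ _ hT] at hq
      rw [(hB q hT).apply_eq_zero hq.symm, zero_mul]
  -- The surviving terms agree: entries of `A` do not depend on the common values of their indices
  -- on `T`, nor those of `B` on the common values off `T`.
  ext x y
  rw [key, key', mul_comm]
  congr 1
  · rw [← apply_piecewise_of_actsTriviallyOn (A := B) Tᶜ (fun q hq => hB q (by simpa using hq))
      (fun q hq => ?_) x]
    · congr 1 <;> (funext q; by_cases hq : q ∈ T <;> simp [hq])
    · simp [Finset.mem_compl.1 hq]
  · rw [← apply_piecewise_of_actsTriviallyOn (A := A) T hA (fun q hq => ?_) y]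
    · congr 1
      funext q
      by_cases hq : q ∈ T <;> simp [hq]
    · simp [hq]

end

end PauliAlgebra

namespace CliffordCircuit

variable {n : ℕ} (C : CliffordCircuit n)

/-! ### The levels of a circuit -/

/-- The Pauli operator, up to phase, of a measurement. -/
abbrev measured (j : C.Measurement) : Pauli (Fin n) := (C.op j).measuredPauli

theorem exists_operator_eq (j : C.Measurement) :
    ∃ s : ZMod 2, (C.op j).operator = bitSign s • (C.measured j).toOperator := by
  obtain ⟨i, hi⟩ := j
  unfold measured
  cases h : C.op i with
  | unitary U hU => rw [h] at hi; exact hi.elim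
  | measurement s P => exact ⟨s, rfl⟩

/-- The projector `(I + (-1) ^ o_i S_i) / 2` of a measurement, and the identity for a unitary. -/
noncomputable def projOp (o : C.BitString) (i : Fin C.size) : Operator (Fin n) :=
  open Classical in
  if h : (C.op i).IsMeasurement then
    (2 : ℂ)⁻¹ • (1 + bitSign (o ⟨i, h⟩) • (C.op i).operator)
  else 1

/-- The operator applied by the level `ℓ` when the outcomes are `o`. -/
noncomputable def levelKraus (o : C.BitString) (ℓ : ℕ) : Operator (Fin n) :=
  ((C.opsAtLevel ℓ).map (C.krausOp o)).reverse.prod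

/-- The product of the projectors of the measurements of level `ℓ`. -/
noncomputable def levelProj (o : C.BitString) (ℓ : ℕ) : Operator (Fin n) :=
  ((C.opsAtLevel ℓ).map (C.projOp o)).reverse.prod

variable {C}

theorem mem_opsAtLevel {ℓ : ℕ} {i : Fin C.size} : i ∈ C.opsAtLevel ℓ ↔ C.level i = ℓ := by
  simp [opsAtLevel]

theorem isClifford_unitaryPart (i : Fin C.size) : IsClifford (C.op i).unitaryPart := by
  cases C.op i with
  | unitary U hU => exact hU
  | measurement s P => exact .one

theorem isClifford_levelUnitary (ℓ : ℕ) : IsClifford (C.levelUnitary ℓ) := by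
  refine .list_prod _ fun A hA => ?_
  simp only [List.mem_reverse, List.mem_map] at hA
  obtain ⟨i, -, rfl⟩ := hA
  exact isClifford_unitaryPart i

theorem krausOp_eq (o : C.BitString) (i : Fin C.size) :
    C.krausOp o i = (C.op i).unitaryPart * C.projOp o i := by
  by_cases h : (C.op i).IsMeasurement
  · have h1 : (C.op i).unitaryPart = 1 := by
      cases hi : C.op i with
      | unitary U hU => rw [hi] at h; exact h.elim
      | measurement s P => rfl
    rw [krausOp, projOp, dif_pos h, dif_pos h, h1, one_mul]
    rfl
  · have h1 : (C.op i).unitaryPart = (C.op i).operator := by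
      cases hi : C.op i with
      | unitary U hU => rfl
      | measurement s P => rw [hi] at h; exact (h trivial).elim
    rw [krausOp, projOp, dif_neg h, dif_neg h, h1, mul_one]

theorem commute_unitaryPart_operator {i : Fin C.size} (j : C.Measurement)
    (h : C.level i = C.level j) : Commute (C.op i).unitaryPart (C.op j).operator := by
  cases hi : C.op i with
  | unitary U hU =>
    have hij : i ≠ j := fun hij => by
      have := j.2
      rw [← hij, hi] at this
      exact this
    have := commute_of_disjoint_support (C.disjoint_support i j hij h)
    rwa [hi] at this
  | measurement s P => exact Commute.one_left _

theorem commute_operator_operator (j k : C.Measurement) (h : C.level j = C.level k) :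
    Commute (C.op j).operator (C.op k).operator := by
  by_cases hjk : (j : Fin C.size) = k
  · rw [hjk]
  · exact commute_of_disjoint_support (C.disjoint_support _ _ hjk h)

theorem commute_toOperator_of_commute_operator {A : Operator (Fin n)} {j : C.Measurement}
    (h : Commute A (C.op j).operator) : Commute A (C.measured j).toOperator := by
  obtain ⟨s, hs⟩ := C.exists_operator_eq j
  have : (C.measured j).toOperator = bitSign s • (C.op j).operator := by
    rw [hs, smul_smul, bitSign_mul_self, one_smul]
  rw [this]
  exact h.smul_right _

theorem sympl_measured (j k : C.Measurement) (h : C.level j = C.level k) :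
    sympl (C.measured j) (C.measured k) = 0 := by
  refine sympl_eq_of_commutation ?_
  rw [bitSign_zero, one_smul]
  exact (commute_toOperator_of_commute_operator (commute_toOperator_of_commute_operator
    (commute_operator_operator j k h)).symm).symm.eq

theorem commute_unitaryPart_projOp (o : C.BitString) {i k : Fin C.size}
    (h : C.level i = C.level k) : Commute (C.op i).unitaryPart (C.projOp o k) := by
  unfold projOp
  split_ifs with hk
  · exact ((Commute.one_right _).add_right
      ((commute_unitaryPart_operator ⟨k, hk⟩ h).smul_right _)).smul_right _
  · exact Commute.one_right _

/-- Operations of one level have disjoint supports, so every unitary can be moved to the left of all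
the projectors. -/
theorem levelKraus_eq (o : C.BitString) (ℓ : ℕ) :
    C.levelKraus o ℓ = C.levelUnitary ℓ * C.levelProj o ℓ := by
  have : ∀ l : List (Fin C.size), (∀ i ∈ l, C.level i = ℓ) →
      (l.map (C.krausOp o)).reverse.prod =
        (l.map fun i => (C.op i).unitaryPart).reverse.prod * (l.map (C.projOp o)).reverse.prod := by
    intro l
    induction l with
    | nil => simp
    | cons a l ih =>
      intro hl
      have hc : Commute (C.op a).unitaryPart (l.map (C.projOp o)).reverse.prod := by
        refine Commute.list_prod_right _ _ fun A hA => ?_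
        simp only [List.mem_reverse, List.mem_map] at hA
        obtain ⟨i, hi, rfl⟩ := hA
        exact commute_unitaryPart_projOp o ((hl a (by simp)).trans (hl i (by simp [hi])).symm)
      simp only [List.map_cons, List.reverse_cons, List.prod_append, List.prod_singleton]
      rw [ih fun i hi => hl i (by simp [hi]), krausOp_eq, mul_assoc, mul_assoc,
        ← mul_assoc _ _ (C.projOp o a), ← hc.eq]
      simp only [mul_assoc]
  exact this _ fun i hi => mem_opsAtLevel.1 hi

/-- Moving `P` past `S_i` multiplies `S_i` by the sign of `[P, S_i]`, which is the same as flipping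
the outcome bit. -/
theorem projOp_mul_toOperator {o o' : C.BitString} (P : Pauli (Fin n)) (i : Fin C.size)
    (h : ∀ hi, o' ⟨i, hi⟩ = o ⟨i, hi⟩ + sympl P (C.measured ⟨i, hi⟩)) :
    C.projOp o i * P.toOperator = P.toOperator * C.projOp o' i := by
  unfold projOp
  split_ifs with hi
  · obtain ⟨s, hs⟩ := C.exists_operator_eq ⟨i, hi⟩
    simp only at hs
    rw [hs, h hi, smul_mul_assoc, mul_smul_comm, add_mul, mul_add, one_mul, mul_one,
      smul_smul, smul_smul, smul_mul_assoc, mul_smul_comm, toOperator_mul_comm P, smul_smul,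
      bitSign_add]
    congr 3
    linear_combination (-bitSign (o ⟨i, hi⟩) * bitSign s) *
      bitSign_mul_self (sympl P (C.measured ⟨i, hi⟩))
  · rw [one_mul, mul_one]

theorem levelProj_mul_toOperator {o o' : C.BitString} (P : Pauli (Fin n)) (ℓ : ℕ)
    (h : ∀ j : C.Measurement, C.level j = ℓ → o' j = o j + sympl P (C.measured j)) :
    C.levelProj o ℓ * P.toOperator = P.toOperator * C.levelProj o' ℓ := by
  have : ∀ l : List (Fin C.size), (∀ i ∈ l, C.level i = ℓ) →
      (l.map (C.projOp o)).reverse.prod * P.toOperator =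
        P.toOperator * (l.map (C.projOp o')).reverse.prod := by
    intro l
    induction l with
    | nil => simp
    | cons a l ih =>
      intro hl
      simp only [List.map_cons, List.reverse_cons, List.prod_append, List.prod_singleton]
      rw [mul_assoc, projOp_mul_toOperator P a fun ha => h ⟨a, ha⟩ (hl a (by simp)), ← mul_assoc,
        ih fun i hi => hl i (by simp [hi]), mul_assoc]
  exact this _ fun i hi => mem_opsAtLevel.1 hi

/-- A Pauli operator is moved past a level, up to a phase that does not depend on the outcomes,
by conjugating it and by flipping the outcomes of the measurements with which it anti-commutes. -/
theorem levelKraus_mul_toOperator (P : Pauli (Fin n)) (ℓ : ℕ) :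
    ∃ c : ℂ, ‖c‖ = 1 ∧ ∀ o o' : C.BitString,
      (∀ j : C.Measurement, C.level j = ℓ → o' j = o j + sympl P (C.measured j)) →
      C.levelKraus o ℓ * P.toOperator =
        c • ((conjugate (C.levelUnitary ℓ) P).toOperator * C.levelKraus o' ℓ) := by
  obtain ⟨c, hc, h⟩ := (isClifford_levelUnitary (C := C) ℓ).mul_toOperator P
  refine ⟨c, hc, fun o o' ho => ?_⟩
  rw [levelKraus_eq, levelKraus_eq, mul_assoc, levelProj_mul_toOperator P ℓ ho, ← mul_assoc, h,
    smul_mul_assoc, mul_assoc]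

/-- The measured operator is absorbed by its measurement. -/
theorem levelKraus_mul_measured (j : C.Measurement) :
    ∃ c : ℂ, ‖c‖ = 1 ∧ ∀ o : C.BitString,
      C.levelKraus o (C.level j) * (C.measured j).toOperator =
        (c * bitSign (o j)) • C.levelKraus o (C.level j) := by
  obtain ⟨s, hs⟩ := C.exists_operator_eq j
  refine ⟨bitSign s, norm_bitSign s, fun o => ?_⟩
  -- The projector has eigenvalue `(-1) ^ o_j` for `S_j`; the factor `bitSign s` accounts for the
  -- sign of `S_j` relative to its Pauli tensor product.
  have hj : C.projOp o j * (C.measured j).toOperator =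
      (bitSign s * bitSign (o j)) • C.projOp o j := by
    unfold projOp
    rw [dif_pos j.2, hs, smul_mul_assoc, smul_comm _ (2 : ℂ)⁻¹, add_mul, one_mul, smul_mul_assoc,
      smul_mul_assoc, toOperator_mul_self, smul_add, smul_smul, smul_smul]
    have h1 : bitSign s * bitSign (o j) * bitSign (o j) * bitSign s = 1 := by
      rw [mul_assoc (bitSign s), bitSign_mul_self, mul_one, bitSign_mul_self]
    simp only [Subtype.coe_eta]
    rw [smul_add, smul_smul, smul_smul, h1, one_smul, smul_add, smul_smul, add_comm, mul_assoc,
      mul_comm (bitSign s)]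
  have : ∀ l : List (Fin C.size), (∀ i ∈ l, C.level i = C.level j) → (j : Fin C.size) ∈ l →
      (l.map (C.projOp o)).reverse.prod * (C.measured j).toOperator =
        (bitSign s * bitSign (o j)) • (l.map (C.projOp o)).reverse.prod := by
    intro l
    induction l with
    | nil => simp
    | cons a l ih =>
      intro hl hjl
      simp only [List.map_cons, List.reverse_cons, List.prod_append, List.prod_singleton]
      by_cases ha : (j : Fin C.size) = a
      · rw [← ha, mul_assoc, hj, mul_smul_comm]
      · have hc : C.projOp o a * (C.measured j).toOperator =
            (C.measured j).toOperator * C.projOp o a :=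
          projOp_mul_toOperator _ a fun ha => by
            rw [sympl_measured j ⟨a, ha⟩ (hl a (by simp)).symm, add_zero]
        rw [mul_assoc, hc, ← mul_assoc, ih (fun i hi => hl i (by simp [hi]))
          ((List.mem_cons.1 hjl).resolve_left ha), smul_mul_assoc]
  rw [levelKraus_eq, mul_assoc, levelProj,
    this _ (fun i hi => mem_opsAtLevel.1 hi) (mem_opsAtLevel.2 rfl), mul_smul_comm]

/-- Iterated absorption: `c` collects the outcome-independent phases, so all the dependence on `o`
is in the sign. -/
theorem levelKraus_mul_sum_measured (u : C.BitString) {ℓ : ℕ} (s : Finset C.Measurement)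
    (hs : ∀ j ∈ s, C.level j = ℓ) :
    ∃ c : ℂ, ‖c‖ = 1 ∧ ∀ o : C.BitString,
      C.levelKraus o ℓ * (∑ j ∈ s, u j • C.measured j).toOperator =
        (c * bitSign (∑ j ∈ s, u j * o j)) • C.levelKraus o ℓ := by
  classical
  induction s using Finset.induction_on with
  | empty => exact ⟨1, by simp, fun o => by simp⟩
  | insert k s hk ih =>
    obtain ⟨c, hc, h⟩ := ih fun j hj => hs j (by simp [hj])
    rcases zmod_two_cases (u k) with hu | hu
    · exact ⟨c, hc, fun o => by simp [Finset.sum_insert hk, hu, h]⟩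
    · obtain ⟨d, hd, h'⟩ := C.levelKraus_mul_measured k
      rw [hs k (by simp)] at h'
      obtain ⟨e, he, h''⟩ :=
        (toOperator_mul (C.measured k) (∑ j ∈ s, u j • C.measured j)).symm
      refine ⟨c * d * e, by simp [hc, hd, he], fun o => ?_⟩
      rw [Finset.sum_insert hk, Finset.sum_insert hk, hu, one_smul, h'', mul_smul_comm,
        ← mul_assoc, h', smul_mul_assoc, h, smul_smul, smul_smul, bitSign_add, one_mul]
      congr 1
      ring

/-! ### Propagation of faults to the end of the circuit -/

@[simp] theorem component_zero (ℓ : ℕ) : FaultOperator.component (0 : C.FaultOperator) ℓ = 0 := by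
  funext q
  simp [FaultOperator.component]

theorem component_place (k ℓ : ℕ) (P : Pauli (Fin n)) (hℓ : ℓ ≤ C.depth) :
    FaultOperator.component (C.place k P) ℓ = if ℓ = k then P else 0 := by
  funext q
  simp only [FaultOperator.component, place, dif_pos (Nat.lt_succ_of_le hℓ)]
  split_ifs <;> rfl

theorem component_place_of_ne {k ℓ : ℕ} (P : Pauli (Fin n)) (h : ℓ ≠ k) :
    FaultOperator.component (C.place k P) ℓ = 0 := by
  funext q
  simp [FaultOperator.component, place, h]

theorem krausUpTo_succ (F : C.FaultOperator) (o : C.BitString) (ℓ : ℕ) :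
    C.krausUpTo F o (ℓ + 1) = (FaultOperator.component F (ℓ + 1)).toOperator *
      C.levelKraus o (ℓ + 1) * C.krausUpTo F o ℓ := rfl

theorem krausUpTo_zero_succ (o : C.BitString) (ℓ : ℕ) :
    C.krausUpTo 0 o (ℓ + 1) = C.levelKraus o (ℓ + 1) * C.krausUpTo 0 o ℓ := by
  rw [krausUpTo_succ, component_zero, toOperator_zero, one_mul]

theorem krausUpTo_zero_zero (o : C.BitString) : C.krausUpTo 0 o 0 = 1 := by
  rw [krausUpTo, component_zero, toOperator_zero]

theorem one_le_level_measurement (j : C.Measurement) : 1 ≤ C.level j := C.one_le_level _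

theorem level_le_depth (i : Fin C.size) : C.level i ≤ C.depth :=
  Finset.le_sup (f := C.level) (Finset.mem_univ i)

variable (C) in
/-- The outcomes that are flipped by a fault operator. -/
noncomputable def flips (F : C.FaultOperator) : C.BitString := (C.eff F).1

theorem flips_apply (F : C.FaultOperator) (j : C.Measurement) :
    C.flips F j = sympl (C.cumulant F (C.level j - 1)) (C.measured j) :=
  pauliCommutator_eq_sympl _ _

/-- The faults accumulated so far form the cumulant; crossing a level conjugates it and flips the
outcomes with which it anti-commutes. -/
theorem krausUpTo_phaseEq (F : C.FaultOperator) (o : C.BitString) (ℓ : ℕ) :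
    PhaseEq (C.krausUpTo F o ℓ)
      ((C.cumulant F ℓ).toOperator * C.krausUpTo 0 (o + C.flips F) ℓ) := by
  induction ℓ with
  | zero => exact .of_eq (by rw [krausUpTo_zero_zero, mul_one]; rfl)
  | succ ℓ ih =>
    obtain ⟨c, hc, h⟩ := levelKraus_mul_toOperator (C := C) (C.cumulant F ℓ) (ℓ + 1)
    have h' : PhaseEq (C.levelKraus o (ℓ + 1) * (C.cumulant F ℓ).toOperator)
        ((conjugate (C.levelUnitary (ℓ + 1)) (C.cumulant F ℓ)).toOperator *
          C.levelKraus (o + C.flips F) (ℓ + 1)) :=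
      ⟨c, hc, h _ _ fun j hj => by rw [Pi.add_apply, flips_apply, hj, Nat.add_sub_cancel]⟩
    rw [krausUpTo_succ, krausUpTo_zero_succ]
    refine ((PhaseEq.refl _).mul ih).trans ?_
    rw [mul_assoc, ← mul_assoc (C.levelKraus o (ℓ + 1))]
    refine ((PhaseEq.refl _).mul (h'.mul (.refl _))).trans ?_
    rw [mul_assoc, ← mul_assoc]
    exact (toOperator_mul _ _).mul (.refl _)

theorem trace_conj_eq_of_phaseEq {A B : Operator (Fin n)} (h : PhaseEq A B)
    (ρ : Operator (Fin n)) : (A * ρ * Aᴴ).trace = (B * ρ * Bᴴ).trace := by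
  obtain ⟨c, hc, rfl⟩ := h
  have : c * star c = 1 := by
    rw [Complex.star_def, Complex.mul_conj, Complex.normSq_eq_norm_sq, hc]
    simp
  rw [Matrix.conjTranspose_smul, smul_mul_assoc, smul_mul_smul_comm, this, one_smul]

theorem trace_toOperator_mul_conj (P : Pauli (Fin n)) (K ρ : Operator (Fin n)) :
    (P.toOperator * K * ρ * (P.toOperator * K)ᴴ).trace = (K * ρ * Kᴴ).trace := by
  rw [Matrix.conjTranspose_mul, conjTranspose_toOperator, mul_assoc, mul_assoc,
    Matrix.trace_mul_comm, ← mul_assoc ρ, ← mul_assoc K, mul_assoc, toOperator_mul_self, mul_one,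
    mul_assoc]

/-- The faults flip outcomes: the distribution of the outcomes is translated. -/
theorem outcomeProb_eq (ρ : Operator (Fin n)) (F : C.FaultOperator) (o : C.BitString) :
    C.outcomeProb ρ F o = C.outcomeProb ρ 0 (o + C.flips F) := by
  rw [outcomeProb, outcomeProb, trace_conj_eq_of_phaseEq (krausUpTo_phaseEq F o C.depth),
    trace_toOperator_mul_conj]

/-! ### Back-propagation of checks -/

/-- The component at level `ℓ + 0.5` of the back-cumulant. -/
noncomputable def back (G : C.FaultOperator) (ℓ : ℕ) : Pauli (Fin n) := C.backCumulantAux G (C.depth - ℓ)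

theorem back_depth (G : C.FaultOperator) :
    back G C.depth = FaultOperator.component G C.depth := by
  rw [back, Nat.sub_self]
  rfl

theorem back_of_lt (G : C.FaultOperator) {ℓ : ℕ} (h : ℓ < C.depth) :
    back G ℓ = FaultOperator.component G ℓ +
      conjugate (C.levelUnitary (ℓ + 1))ᴴ (back G (ℓ + 1)) := by
  obtain ⟨k, hk⟩ : ∃ k, C.depth - ℓ = k + 1 := ⟨C.depth - ℓ - 1, by omega⟩
  rw [back, back, hk, backCumulantAux, show C.depth - (k + 1) = ℓ by omega,
    show C.depth - k = ℓ + 1 by omega, show C.depth - (ℓ + 1) = k by omega]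

theorem component_backCumulant (G : C.FaultOperator) {ℓ : ℕ} (h : ℓ ≤ C.depth) :
    FaultOperator.component (C.backCumulant G) ℓ = back G ℓ := by
  funext q
  simp only [FaultOperator.component, dif_pos (Nat.lt_succ_of_le h)]
  rfl

theorem sympl_faultOperator (G F : C.FaultOperator) :
    sympl G F = ∑ ℓ ∈ Finset.range (C.depth + 1),
      sympl (FaultOperator.component G ℓ) (FaultOperator.component F ℓ) := by
  rw [Finset.sum_range]
  unfold sympl
  rw [Fintype.sum_prod_type]
  refine Finset.sum_congr rfl fun ℓ _ => Finset.sum_congr rfl fun q _ => ?_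
  simp only [FaultOperator.component, dif_pos ℓ.2]

/-- Summation by parts: adjointness moves each conjugation from `back G` to the cumulant of `F`,
leaving one boundary term at `k`. -/
theorem sum_sympl_back (G F : C.FaultOperator) (k : ℕ) (hk : k ≤ C.depth) :
    ∑ ℓ ∈ Finset.range (k + 1), sympl (back G ℓ) (FaultOperator.component F ℓ) =
      ∑ ℓ ∈ Finset.range k, sympl (FaultOperator.component G ℓ) (C.cumulant F ℓ) +
        sympl (back G k) (C.cumulant F k) := by
  induction k with
  | zero => simp [cumulant]
  | succ k ih =>
    rw [Finset.sum_range_succ, ih (by omega), Finset.sum_range_succ, back_of_lt G hk,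
      sympl_add_left, (isClifford_levelUnitary _).sympl_conjugate_conjTranspose, cumulant,
      sympl_add_right]
    ring

/-- The adjointness of the cumulant and of the back-cumulant. -/
theorem sympl_backCumulant (G F : C.FaultOperator) :
    sympl (C.backCumulant G) F = ∑ ℓ ∈ Finset.range (C.depth + 1),
      sympl (FaultOperator.component G ℓ) (C.cumulant F ℓ) := by
  rw [sympl_faultOperator, Finset.sum_range_succ (fun ℓ => sympl _ (C.cumulant F ℓ)), ← back_depth,
    ← sum_sympl_back G F C.depth le_rfl]
  refine Finset.sum_congr rfl fun ℓ hℓ => ?_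
  rw [component_backCumulant G (Nat.lt_succ_iff.1 (Finset.mem_range.1 hℓ))]

theorem component_checkFault (u : C.BitString) {ℓ : ℕ} (hℓ : ℓ ≤ C.depth) :
    FaultOperator.component (C.checkFault u) ℓ =
      ∑ j : C.Measurement with C.level (j : C.Measurement) = ℓ + 1, u j • C.measured j := by
  rw [Finset.sum_filter]
  funext q
  simp only [FaultOperator.component, dif_pos (Nat.lt_succ_of_le hℓ), checkFault, place,
    Finset.sum_apply, Pi.smul_apply]
  refine Finset.sum_congr rfl fun j _ => ?_
  -- Levels start at `1`, so the truncated subtraction `level j - 1` is exact.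
  have := one_le_level_measurement j
  by_cases h : C.level j = ℓ + 1
  · simp [h]
  · rw [if_neg h, if_neg (by omega), smul_zero]
    rfl

/-- The syndrome of a fault operator for a check operator is the parity of the outcomes that it
flips among those that are involved in the check. -/
theorem sympl_checkOperator (u : C.BitString) (F : C.FaultOperator) :
    sympl (C.checkOperator u) F = u ⬝ᵥ C.flips F := by
  have h : ∀ ℓ ∈ Finset.range (C.depth + 1),
      sympl (FaultOperator.component (C.checkFault u) ℓ) (C.cumulant F ℓ) =
        ∑ j : C.Measurement, if C.level j - 1 = ℓ then u j * C.flips F j else 0 := fun ℓ hℓ => by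
    rw [component_checkFault u (Nat.lt_succ_iff.1 (Finset.mem_range.1 hℓ)), sympl_sum_left,
      Finset.sum_filter]
    refine Finset.sum_congr rfl fun j _ => ?_
    have := one_le_level_measurement j
    by_cases hj : C.level j = ℓ + 1
    · rw [if_pos hj, if_pos (by omega), sympl_smul_left, flips_apply, sympl_comm, hj,
        Nat.add_sub_cancel]
    · rw [if_neg hj, if_neg (by omega)]
  rw [checkOperator, sympl_backCumulant, Finset.sum_congr rfl h, Finset.sum_comm]
  refine Finset.sum_congr rfl fun j _ => ?_
  rw [Finset.sum_ite_eq, if_pos]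
  have := level_le_depth (j : Fin C.size)
  exact Finset.mem_range.2 (by omega)

theorem sympl_place (G : C.FaultOperator) {k : ℕ} (hk : k ≤ C.depth) (P : Pauli (Fin n)) :
    sympl G (C.place k P) = sympl (FaultOperator.component G k) P := by
  rw [sympl_faultOperator, Finset.sum_eq_single k]
  · rw [component_place k k P hk, if_pos rfl]
  · intro ℓ _ hℓ
    rw [component_place_of_ne P hℓ, sympl_zero_right]
  · intro h
    exact absurd (Finset.mem_range.2 (Nat.lt_succ_of_le hk)) h

/-! ### Translations that preserve the distribution of the outcomes -/

/-- The probability of an outcome for the maximally mixed state in the absence of faults. -/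
noncomputable def mixedProb (o : C.BitString) : ℝ := C.outcomeProb (maximallyMixed (Fin n)) 0 o

variable (C) in
/-- The translations that preserve the distribution of the outcomes for the maximally mixed
state. -/
def translations : Submodule (ZMod 2) C.BitString where
  carrier := {w | ∀ o : C.BitString, mixedProb (o + w) = mixedProb o}
  add_mem' := fun {a b} ha hb o => by rw [← add_assoc, hb, ha]
  zero_mem' := fun o => by rw [add_zero]
  smul_mem' := fun c w hw o => by
    rcases zmod_two_cases c with rfl | rfl
    · rw [zero_smul, add_zero]
    · rw [one_smul, hw]

theorem mem_translations {w : C.BitString} :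
    w ∈ C.translations ↔ ∀ o : C.BitString, mixedProb (o + w) = mixedProb o := Iff.rfl

theorem outcomeProb_maximallyMixed (F : C.FaultOperator) (o : C.BitString) :
    C.outcomeProb (maximallyMixed (Fin n)) F o =
      (((2 : ℂ) ^ n)⁻¹ * (C.krausUpTo F o C.depth * (C.krausUpTo F o C.depth)ᴴ).trace).re := by
  simp [outcomeProb, maximallyMixed]

theorem krausUpTo_place_zero (P : Pauli (Fin n)) (o : C.BitString) (ℓ : ℕ) :
    C.krausUpTo (C.place 0 P) o ℓ = C.krausUpTo 0 o ℓ * P.toOperator := by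
  induction ℓ with
  | zero => rw [krausUpTo_zero_zero, one_mul, krausUpTo, component_place _ _ _ (Nat.zero_le _),
      if_pos rfl]
  | succ ℓ ih => rw [krausUpTo_zero_succ, krausUpTo_succ, component_place_of_ne P (by simp), ih,
      toOperator_zero, one_mul, mul_assoc]

/-- A Pauli on the input translates the distribution by its flips, yet it fixes the maximally mixed
state, so the distribution does not change. -/
theorem flips_place_zero_mem (P : Pauli (Fin n)) :
    C.flips (C.place 0 P) ∈ C.translations := mem_translations.2 fun o => by
  rw [mixedProb, ← outcomeProb_eq, outcomeProb_maximallyMixed, mixedProb,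
    outcomeProb_maximallyMixed, krausUpTo_place_zero, Matrix.conjTranspose_mul,
    conjTranspose_toOperator, mul_assoc, ← mul_assoc P.toOperator, toOperator_mul_self, one_mul]

theorem krausUpTo_place_of_lt {k : ℕ} (P : Pauli (Fin n)) (o : C.BitString) {ℓ : ℕ} (h : ℓ < k) :
    C.krausUpTo (C.place k P) o ℓ = C.krausUpTo 0 o ℓ := by
  induction ℓ with
  | zero => rw [krausUpTo_zero_zero, krausUpTo, component_place_of_ne P h.ne, toOperator_zero]
  | succ ℓ ih => rw [krausUpTo_zero_succ, krausUpTo_succ, component_place_of_ne P h.ne,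
      ih (by omega), toOperator_zero, one_mul]

theorem krausUpTo_place_self {k : ℕ} (hk : k ≤ C.depth) (P : Pauli (Fin n)) (o : C.BitString) :
    C.krausUpTo (C.place k P) o k = P.toOperator * C.krausUpTo 0 o k := by
  cases k with
  | zero => rw [krausUpTo_zero_zero, krausUpTo, component_place _ _ _ hk, if_pos rfl, mul_one]
  | succ k => rw [krausUpTo_zero_succ, krausUpTo_succ, component_place _ _ _ hk, if_pos rfl,
      krausUpTo_place_of_lt P o (Nat.lt_succ_self k), mul_assoc]

/-- A fault that is equal to the operator measured right after it has no effect. -/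
theorem krausUpTo_place_measured (j : C.Measurement) (o : C.BitString) {ℓ : ℕ}
    (h : C.level j ≤ ℓ) :
    PhaseEq (C.krausUpTo (C.place (C.level j - 1) (C.measured j)) o ℓ) (C.krausUpTo 0 o ℓ) := by
  have hj := one_le_level_measurement j
  have hj' := level_le_depth (j : Fin C.size)
  induction ℓ, h using Nat.le_induction with
  | base =>
    obtain ⟨k, hk⟩ : ∃ k, C.level j = k + 1 := ⟨C.level j - 1, by omega⟩
    obtain ⟨c, hc, h⟩ := C.levelKraus_mul_measured j
    refine ⟨c * bitSign (o j), by simp [hc, norm_bitSign], ?_⟩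
    have h' := h o
    rw [hk] at h' ⊢
    rw [Nat.add_sub_cancel, krausUpTo_succ, component_place_of_ne _ (by omega), toOperator_zero,
      one_mul, krausUpTo_place_self (by omega), ← mul_assoc, h', krausUpTo_zero_succ,
      smul_mul_assoc]
  | succ ℓ hℓ ih =>
    rw [krausUpTo_succ, component_place_of_ne _ (by omega), toOperator_zero, one_mul,
      krausUpTo_zero_succ]
    exact (PhaseEq.refl _).mul ih

theorem flips_place_measured_mem (j : C.Measurement) :
    C.flips (C.place (C.level j - 1) (C.measured j)) ∈ C.translations :=
  mem_translations.2 fun o => by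
    rw [mixedProb, ← outcomeProb_eq, mixedProb, outcomeProb, outcomeProb,
      trace_conj_eq_of_phaseEq (krausUpTo_place_measured j o (level_le_depth _))]

/-! ### Checks determine the outcomes -/

section Checks

variable {u : C.BitString} (hu : ∀ w ∈ C.translations, u ⬝ᵥ w = 0)

include hu

/-- Input faults cause flips that are translations, so the check operator commutes with every Pauli
at the input. -/
theorem back_checkFault_zero : back (C.checkFault u) 0 = 0 := by
  refine eq_zero_of_sympl_eq_zero _ fun P => ?_
  have h := hu _ (flips_place_zero_mem P)
  rwa [← sympl_checkOperator, sympl_place _ (Nat.zero_le _), checkOperator,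
    component_backCumulant _ (Nat.zero_le _)] at h

theorem sympl_back_checkFault (j : C.Measurement) :
    sympl (back (C.checkFault u) (C.level j - 1)) (C.measured j) = 0 := by
  have hj : C.level j - 1 ≤ C.depth := (Nat.sub_le _ _).trans (level_le_depth _)
  have h := hu _ (flips_place_measured_mem j)
  rwa [← sympl_checkOperator, sympl_place _ hj, checkOperator, component_backCumulant _ hj] at h

/-- Up to phase `back` at `ℓ` is `G Q`. The measurements absorb `G`, which produces the sign, while
`Q` crosses the level without flipping an outcome and becomes `back` at `ℓ + 1`. -/
theorem levelKraus_mul_back {ℓ : ℕ} (hℓ : ℓ < C.depth) :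
    ∃ c : ℂ, ∀ o : C.BitString,
      C.levelKraus o (ℓ + 1) * (back (C.checkFault u) ℓ).toOperator =
        (c * bitSign (∑ j : C.Measurement with C.level (j : C.Measurement) = ℓ + 1, u j * o j)) •
          ((back (C.checkFault u) (ℓ + 1)).toOperator * C.levelKraus o (ℓ + 1)) := by
  have hG := component_checkFault u hℓ.le
  set G := FaultOperator.component (C.checkFault u) ℓ
  set Q := conjugate (C.levelUnitary (ℓ + 1))ᴴ (back (C.checkFault u) (ℓ + 1)) with hQ
  have hGQ : back (C.checkFault u) ℓ = G + Q := back_of_lt _ hℓ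
  obtain ⟨c, -, hc⟩ := (toOperator_mul G Q).symm
  obtain ⟨d, -, hd⟩ := levelKraus_mul_sum_measured u (ℓ := ℓ + 1)
    (Finset.univ.filter fun j : C.Measurement => C.level j = ℓ + 1)
    fun j hj => (Finset.mem_filter.1 hj).2
  obtain ⟨e, -, he⟩ := levelKraus_mul_toOperator (C := C) Q (ℓ + 1)
  -- Both `G Q` and `G` commute with each operator measured at this level, hence so does `Q`.
  have hQ0 : ∀ j : C.Measurement, C.level j = ℓ + 1 → sympl Q (C.measured j) = 0 := by
    intro j hj
    have h1 := sympl_back_checkFault hu j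
    rw [hj, Nat.add_sub_cancel, hGQ, sympl_add_left, hG, sympl_sum_left,
      Finset.sum_eq_zero, zero_add] at h1
    · exact h1
    · intro k hk
      rw [sympl_smul_left, sympl_measured k j ((Finset.mem_filter.1 hk).2.trans hj.symm), mul_zero]
  refine ⟨c * d * e, fun o => ?_⟩
  rw [hGQ, hc, mul_smul_comm, ← mul_assoc, hG, hd, smul_mul_assoc,
    he o o fun j hj => by rw [hQ0 j hj, add_zero], hQ,
    (isClifford_levelUnitary _).conjugate_conjugate_conjTranspose, smul_smul, smul_smul]
  congr 1
  ring

/-- Since `back` is the identity at the input, it can be inserted there and carried through the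
levels. -/
theorem krausUpTo_eq_smul_back (ℓ : ℕ) (hℓ : ℓ ≤ C.depth) :
    ∃ c : ℂ, ∀ o : C.BitString, C.krausUpTo 0 o ℓ =
      (c * bitSign (∑ j : C.Measurement with C.level (j : C.Measurement) ≤ ℓ, u j * o j)) •
        ((back (C.checkFault u) ℓ).toOperator * C.krausUpTo 0 o ℓ) := by
  induction ℓ with
  | zero =>
    refine ⟨1, fun o => ?_⟩
    rw [back_checkFault_zero hu, Finset.sum_eq_zero]
    · simp
    · intro j hj
      have := one_le_level_measurement j
      have := (Finset.mem_filter.1 hj).2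
      omega
  | succ ℓ ih =>
    obtain ⟨c, hc⟩ := ih (by omega)
    obtain ⟨d, hd⟩ := levelKraus_mul_back hu (ℓ := ℓ) (by omega)
    refine ⟨c * d, fun o => ?_⟩
    have hsum : ∑ j : C.Measurement with C.level (j : C.Measurement) ≤ ℓ + 1, u j * o j =
        ∑ j : C.Measurement with C.level (j : C.Measurement) ≤ ℓ, u j * o j +
          ∑ j : C.Measurement with C.level (j : C.Measurement) = ℓ + 1, u j * o j := by
      rw [← Finset.sum_union (Finset.disjoint_filter.2 fun j _ h h' => by omega),
        ← Finset.filter_or]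
      exact Finset.sum_congr (Finset.filter_congr fun j _ => by omega) fun _ _ => rfl
    rw [krausUpTo_zero_succ]
    conv_lhs => rw [hc o, mul_smul_comm, ← mul_assoc, hd o, smul_mul_assoc, smul_smul]
    rw [hsum, bitSign_add, mul_assoc (back _ _).toOperator]
    congr 1
    ring

theorem krausUpTo_depth_eq_smul :
    ∃ c : ℂ, ∀ o : C.BitString, C.krausUpTo 0 o C.depth =
      (c * bitSign (u ⬝ᵥ o)) • C.krausUpTo 0 o C.depth := by
  obtain ⟨c, hc⟩ := krausUpTo_eq_smul_back hu C.depth le_rfl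
  refine ⟨c, fun o => ?_⟩
  -- No measurement has level `depth + 1`, so `F(u)` is trivial after the last level.
  have h0 : back (C.checkFault u) C.depth = 0 := by
    rw [back_depth, component_checkFault u le_rfl]
    refine Finset.sum_eq_zero fun j hj => ?_
    have := level_le_depth (j : Fin C.size)
    have := (Finset.mem_filter.1 hj).2
    omega
  have hsum : ∑ j : C.Measurement with C.level (j : C.Measurement) ≤ C.depth, u j * o j = u ⬝ᵥ o := by
    rw [Finset.filter_true_of_mem fun j _ => level_le_depth _]
    rfl
  have h := hc o
  rwa [h0, toOperator_zero, one_mul, hsum] at h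

/-- The parity of a check is the same for all the possible outcomes. -/
theorem dotProduct_eq_of_krausUpTo_ne_zero {o o' : C.BitString}
    (ho : C.krausUpTo 0 o C.depth ≠ 0) (ho' : C.krausUpTo 0 o' C.depth ≠ 0) :
    u ⬝ᵥ o = u ⬝ᵥ o' := by
  obtain ⟨c, hc⟩ := krausUpTo_depth_eq_smul hu
  have key : ∀ o : C.BitString, C.krausUpTo 0 o C.depth ≠ 0 → c * bitSign (u ⬝ᵥ o) = 1 := by
    intro o ho
    have h := hc o
    nth_rewrite 1 [← one_smul ℂ (C.krausUpTo 0 o C.depth)] at h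
    exact (smul_left_injective ℂ ho h).symm
  have h := (key o ho).trans (key o' ho').symm
  have hc0 : c ≠ 0 := fun h0 => by simpa [h0] using key o ho
  exact bitSign_injective (mul_left_cancel₀ hc0 h)

end Checks

/-! ### The outcome code -/

theorem krausUpTo_ne_zero_of_mem {o : C.BitString} (ho : o ∈ C.outcomeCode) :
    C.krausUpTo 0 o C.depth ≠ 0 := by
  obtain ⟨ρ, -, hρ⟩ := ho
  intro h
  simp [outcomeProb, h] at hρ

theorem isState_maximallyMixed : IsState (maximallyMixed (Fin n)) := by
  refine ⟨Matrix.PosSemidef.one.smul (by positivity), ?_⟩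
  simp [maximallyMixed]

theorem outcomeProb_maximallyMixed_nonneg (F : C.FaultOperator) (o : C.BitString) :
    0 ≤ C.outcomeProb (maximallyMixed (Fin n)) F o := by
  have h : (0 : ℂ) ≤ ((2 : ℂ) ^ n)⁻¹ *
      (C.krausUpTo F o C.depth * (C.krausUpTo F o C.depth)ᴴ).trace :=
    mul_nonneg (by positivity) (Matrix.posSemidef_self_mul_conjTranspose _).trace_nonneg
  rw [outcomeProb_maximallyMixed]
  exact (Complex.le_def.1 h).1

/-- The trace of `K Kᴴ` is positive as soon as `K ≠ 0`, so the mixed state detects every possible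
outcome. -/
theorem mixedProb_pos_of_krausUpTo_ne_zero {o : C.BitString}
    (h : C.krausUpTo 0 o C.depth ≠ 0) : 0 < mixedProb o := by
  have h' : (0 : ℂ) < ((2 : ℂ) ^ n)⁻¹ *
      (C.krausUpTo 0 o C.depth * (C.krausUpTo 0 o C.depth)ᴴ).trace :=
    mul_pos (by positivity) (lt_of_le_of_ne
      (Matrix.posSemidef_self_mul_conjTranspose _).trace_nonneg
      fun h0 => h (Matrix.trace_mul_conjTranspose_self_eq_zero_iff.1 h0.symm))
  rw [mixedProb, outcomeProb_maximallyMixed]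
  exact (Complex.lt_def.1 h').1

theorem mem_outcomeCode_iff {o : C.BitString} : o ∈ C.outcomeCode ↔ 0 < mixedProb o :=
  ⟨fun h => mixedProb_pos_of_krausUpTo_ne_zero (krausUpTo_ne_zero_of_mem h),
    fun h => ⟨_, isState_maximallyMixed, h⟩⟩

theorem mem_of_forall_dotProduct_eq_zero {m : Type*} [Fintype m]
    {W : Submodule (ZMod 2) (m → ZMod 2)} {v : m → ZMod 2}
    (h : ∀ u : m → ZMod 2, (∀ w ∈ W, u ⬝ᵥ w = 0) → u ⬝ᵥ v = 0) : v ∈ W := by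
  classical
  by_contra hv
  obtain ⟨f, hf, hW⟩ := Submodule.exists_dual_map_eq_bot_of_notMem hv inferInstance
  -- The values of `f` on the standard basis form the vector that represents `f` by the dot product.
  have key : ∀ x, (fun i => f fun j => if i = j then 1 else 0) ⬝ᵥ x = f x := fun x => by
    rw [f.pi_apply_eq_sum_univ x, dotProduct]
    exact Finset.sum_congr rfl fun i _ => mul_comm _ _
  refine hf ((key v).symm.trans (h _ fun w hw => ?_))
  rw [key, ← Submodule.mem_bot (ZMod 2), ← hW]
  exact Submodule.mem_map_of_mem hw

/-- An outcome code that contains `0` is the space of the translations that preserve the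
distribution of the outcomes. In particular, this distribution is uniform. -/
theorem mem_outcomeCode_iff_mem_translations (h0 : (0 : C.BitString) ∈ C.outcomeCode)
    {o : C.BitString} : o ∈ C.outcomeCode ↔ o ∈ C.translations := by
  constructor
  · intro ho
    refine mem_of_forall_dotProduct_eq_zero fun u hu => ?_
    rw [dotProduct_eq_of_krausUpTo_ne_zero hu (krausUpTo_ne_zero_of_mem ho)
      (krausUpTo_ne_zero_of_mem h0), dotProduct_zero]
  · intro ho
    have h := mem_translations.1 ho 0
    rw [zero_add] at h
    rw [mem_outcomeCode_iff] at h0 ⊢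
    rwa [h]

theorem mem_outcomeCode_iff_outcomeSyndrome (h0 : (0 : C.BitString) ∈ C.outcomeCode)
    {r : ℕ} {u : Fin r → C.BitString}
    (hu : Submodule.span (ZMod 2) (Set.range u) = C.dualOutcomeCode) (o : C.BitString) :
    o ∈ C.outcomeCode ↔ C.outcomeSyndrome u o = 0 := by
  constructor
  · intro ho
    funext i
    have hi : u i ∈ C.dualOutcomeCode := hu ▸ Submodule.subset_span ⟨i, rfl⟩
    exact hi o ho
  · intro ho
    rw [mem_outcomeCode_iff_mem_translations h0]
    refine mem_of_forall_dotProduct_eq_zero fun v hv => ?_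
    have hv' : v ∈ Submodule.span (ZMod 2) (Set.range u) := by
      -- The outcome code equals the translations, so a vector orthogonal to the latter is a check.
      rw [hu]
      exact fun w hw => hv w ((mem_outcomeCode_iff_mem_translations h0).1 hw)
    clear hv
    induction hv' using Submodule.span_induction with
    | mem x hx => obtain ⟨_, rfl⟩ := hx; exact congrFun ho _
    | zero => exact zero_dotProduct _
    | add x y _ _ hx hy => rw [add_dotProduct, hx, hy, add_zero]
    | smul a x _ hx => rw [smul_dotProduct, hx, smul_zero]

theorem stabilizerSyndrome_checkOperator {r : ℕ} (u : Fin r → C.BitString) (F : C.FaultOperator) :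
    stabilizerSyndrome (fun i => C.checkOperator (u i)) F = C.outcomeSyndrome u (C.flips F) :=
  funext fun i => (pauliCommutator_eq_sympl _ _).trans (sympl_checkOperator _ _)

end CliffordCircuit

end SpacetimeCode

open SpacetimeCode.CliffordCircuit in
/-- The hypothesis `h0` says that the outcome code is linear: it is always an affine subspace, so
that it is linear as soon as it contains `0`. -/
theorem mainTheorem3 {n : ℕ} (C : SpacetimeCode.CliffordCircuit n)
    (h0 : (0 : C.BitString) ∈ C.outcomeCode)
    (p : C.FaultOperator → ℝ) (hp : p ∈ stdSimplex ℝ C.FaultOperator)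
    {r : ℕ} (u : Fin r → C.BitString)
    (hu : Submodule.span (ZMod 2) (Set.range u) = C.dualOutcomeCode)
    (D : (Fin r → ZMod 2) → C.FaultOperator)
    (hD : SpacetimeCode.IsMLEDecoder (fun i => C.checkOperator (u i)) p D) :
    C.IsMLFDecoder p (C.eff ∘ D ∘ C.outcomeSyndrome u) := by
  intro o
  refine ⟨D (C.outcomeSyndrome u o), fun G => ?_, rfl⟩
  set F := D (C.outcomeSyndrome u o) with hF
  -- `H` can explain `o` exactly when its spacetime syndrome is the outcome syndrome of `o`.
  have hmem : ∀ H : C.FaultOperator,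
      o + C.flips H ∈ C.outcomeCode ↔
        SpacetimeCode.stabilizerSyndrome (fun i => C.checkOperator (u i)) H =
          C.outcomeSyndrome u o := fun H => by
    rw [mem_outcomeCode_iff_outcomeSyndrome h0 hu, stabilizerSyndrome_checkOperator]
    have : C.outcomeSyndrome u (o + C.flips H) =
        C.outcomeSyndrome u o + C.outcomeSyndrome u (C.flips H) :=
      funext fun i => dotProduct_add _ _ _
    rw [this]
    constructor
    · intro h
      rw [eq_neg_of_add_eq_zero_right h, ZModModule.neg_eq_self]
    · intro h
      rw [h, ZModModule.add_self]
  unfold mlfWeight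
  -- If `G` can explain `o`, the syndrome is attained and `hD` applies. Otherwise the weight of `G`
  -- is zero, and nothing need be known about `D` at this syndrome.
  by_cases hG : o + C.flips G ∈ C.outcomeCode
  · obtain ⟨hD1, hD2⟩ := hD _ ⟨G, (hmem G).1 hG⟩
    have hFmem := (hmem F).2 hD1
    -- Uniformity: every fault that can explain `o` gives it the probability of the fault-free
    -- outcome `0`.
    have hprob : ∀ H : C.FaultOperator, o + C.flips H ∈ C.outcomeCode →
        C.outcomeProb (SpacetimeCode.maximallyMixed (Fin n)) H o = mixedProb (0 : C.BitString) :=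
      fun H hH => by
        rw [outcomeProb_eq, ← zero_add (o + C.flips H)]
        exact mem_translations.1 ((mem_outcomeCode_iff_mem_translations h0).1 hH) 0
    rw [hprob G hG, hprob F hFmem]
    exact mul_le_mul_of_nonneg_left (hD2 G ((hmem G).1 hG)) (outcomeProb_maximallyMixed_nonneg _ _)
  · have hzero : C.outcomeProb (SpacetimeCode.maximallyMixed (Fin n)) G o = 0 := by
      refine le_antisymm (not_lt.1 fun h => hG ?_) (outcomeProb_maximallyMixed_nonneg _ _)
      rw [outcomeProb_eq] at h
      exact mem_outcomeCode_iff.2 h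
    rw [hzero, zero_mul]
    exact mul_nonneg (outcomeProb_maximallyMixed_nonneg _ _) (hp.1 _)
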